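/- Define non-negative integers $a_{n,l}$ ($n,l\ge 0$) by $a_{0,0}=1$, $a_{n,0}=0$ for $n>0$, and $$a_{n,l}=\sum_{i=l-1}^{n-1} a_{i,l-1}\binom{2n+l-1}{2n-2i}\qquad(l\ge 1),$$ an empty sum being $0$. For integers $n\ge k\ge 1$ define the rational number $P^{(k)}(n)$ (the value at $n$ of the $k$-th $P$-polynomial) by $$a_{n,l}=\frac{(2n)!}{6^n}\,l\binom{2n+l}{2n}P^{(n+1-l)}(n)\qquad(1\le l\le n).$$ For every integer $k\ge 1$ the series $$c_k=\sum_{n=1}^{\infty}\frac{n(n+1)\,P^{(k)}(n+k-1)}{(2n+2k-3)(2n+2k-2)(2n+2k-1)(2n+2k)}\left(\frac{\pi}{6\sqrt6}\right)^{2n}$$ converges absolutely. The series $\sum_{k\ge1}(-1)^{k+1}c_k\left(\frac{\pi}{6\sqrt6}\right)^{2k}$ also converges absolutely, and $$\zeta(3)=\frac{\pi^2}{8}-\frac{\pi^2}{12}\ln\left(\frac{\pi}{3}\right)+36\sum_{k=1}^{\infty}(-1)^{k+1}c_k\left(\frac{\pi}{6\sqrt6}\right)^{2k}.$$ -/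

import Mathlib

/-- The numbers `a_{n,l}` of Riordan attached to the central factorial numbers:
`a_{0,0} = 1`, `a_{n,0} = 0` for `n > 0`, and
`a_{n,l} = ∑_{i=l-1}^{n-1} a_{i,l-1} * binom (2n+l-1) (2n-2i)` for `l ≥ 1`. -/
def riordanA : ℕ → ℕ → ℕ
  | n, 0 => if n = 0 then 1 else 0
  | n, l + 1 => ∑ i ∈ Finset.Ico l n, riordanA i l * (2 * n + l).choose (2 * n - 2 * i)

/-- The value `P^{(k)}(n)` of the `k`-th P-polynomial at an integer `n ≥ k ≥ 1`, determined by
`a_{n,l} = (2n)!/6^n * l * binom (2n+l) (2n) * P^{(n+1-l)}(n)` for `1 ≤ l ≤ n`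
(so that `k = n + 1 - l`, that is `l = n + 1 - k`). -/
def bernoulliP (k n : ℕ) : ℚ :=
  6 ^ n * (riordanA n (n + 1 - k) : ℚ) /
    (((2 * n).factorial : ℚ) * ((n + 1 - k : ℕ) : ℚ) *
      ((2 * n + (n + 1 - k)).choose (2 * n) : ℚ))

/-- The `n`-th term (`n ≥ 1`) of the series defining `c_k` (`k ≥ 1`). -/
noncomputable def zetaThreeCoeffTerm (k n : ℕ) : ℝ :=
  (n : ℝ) * ((n : ℝ) + 1) * (bernoulliP k (n + k - 1) : ℝ) /
      ((2 * (n : ℝ) + 2 * (k : ℝ) - 3) * (2 * (n : ℝ) + 2 * (k : ℝ) - 2) *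
        (2 * (n : ℝ) + 2 * (k : ℝ) - 1) * (2 * (n : ℝ) + 2 * (k : ℝ))) *
    (Real.pi / (6 * Real.sqrt 6)) ^ (2 * n)

/-- The coefficient `c_k` (`k ≥ 1`), a sum over `n ≥ 1`. -/
noncomputable def zetaThreeCoeff (k : ℕ) : ℝ :=
  ∑' n : ℕ, zetaThreeCoeffTerm k (n + 1)

/-! Put S(X) = ∑ X^j/(2j+3)!, so sinh x - x = x³ S(x²). Riordan's recurrence says ∑_n a_{n,l}
x^(2n+l)/(2n+l)! = (sinh x - x)^l / l! (`riordanA_add`), so P^(j+1)(N+j) is 6^(N+j)/N times the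
coefficient of X^j in S^N.

The quartic denominator in c_k is a Beta integral against (1-v)³. With y = π/6, the double series
over n and k is therefore π²/1296 times the integral over [0,1] of (1-v)³ v⁻² ∑_m (m+2) u^(m+1),
where u = 1 - sin(vy)/(vy) arises from S at -(vy)². The sum over m is 1/(1-u)² - 1, so the integrand
is (1-v)³ (y²/sin²(vy) - 1/v²). Absolute convergence follows from nonnegativity of the coefficients
and x S(x) < 1 on [0,1].

Two integrations by parts leave ∫ (1-v) log sin(vy). The Fourier series of log(2 sin(θ/2)) turns it
into ∑ (1 - cos(nπ/3))/n³, which is (2/3) ζ(3). The choice y = π/6 makes this cosine sum a rational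
multiple of ζ(3). -/

/-! ### Riordan numbers as coefficients of powers of sinh x - x -/

open PowerSeries in
/-- The power series `∑ X ^ j / (2 j + 3)!`, so that `sinh x - x = x ^ 3 * sinhTail (x ^ 2)`. -/
noncomputable def sinhTail : PowerSeries ℝ := PowerSeries.mk fun j => 1 / ((2 * j + 3).factorial : ℝ)

/-- Coefficient form of (F^(l+1))' = (l+1) F^l F' for F = sinh x - x = x³ S(x²): the left factor is
the exponent of x, and 1/(2p+2)! are the coefficients of F' = cosh x - 1. -/
theorem coeff_sinhTail_pow_succ (l j : ℕ) :
    (3 * (l : ℝ) + 3 + 2 * j) * PowerSeries.coeff j (sinhTail ^ (l + 1)) =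
      (l + 1) * ∑ p ∈ Finset.HasAntidiagonal.antidiagonal j, PowerSeries.coeff p.1 (sinhTail ^ l) *
        (1 / ((2 * p.2 + 2).factorial : ℝ)) := by
  have hX : ∀ (f : PowerSeries ℝ) (n : ℕ), PowerSeries.coeff n
      (PowerSeries.X * PowerSeries.derivative ℝ f) = n * PowerSeries.coeff n f := by
    intro f n
    cases n with
    | zero => simp
    | succ n => simp [PowerSeries.coeff_succ_X_mul, PowerSeries.coeff_derivative]; ring
  have hD : (3 * ((l : PowerSeries ℝ) + 1)) * sinhTail ^ (l + 1) +
      2 * (PowerSeries.X * PowerSeries.derivative ℝ (sinhTail ^ (l + 1))) =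
      ((l : PowerSeries ℝ) + 1) * (sinhTail ^ l * (3 * sinhTail +
        2 * (PowerSeries.X * PowerSeries.derivative ℝ sinhTail))) := by
    rw [Derivation.leibniz_pow]
    simp
    ring
  have h := congrArg (PowerSeries.coeff j) hD
  have e1 : (3 * ((l : PowerSeries ℝ) + 1)) = PowerSeries.C (3 * ((l : ℝ) + 1)) := by
    rw [map_mul, map_add, map_natCast, map_one, map_ofNat]
  have e2 : (2 : PowerSeries ℝ) = PowerSeries.C (2 : ℝ) := (map_ofNat _ 2).symm
  have e3 : ((l : PowerSeries ℝ) + 1) = PowerSeries.C ((l : ℝ) + 1) := by simp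
  have e4 : (3 : PowerSeries ℝ) = PowerSeries.C (3 : ℝ) := (map_ofNat _ 3).symm
  have e5 : (3 * sinhTail + 2 * (PowerSeries.X * PowerSeries.derivative ℝ sinhTail)) =
      PowerSeries.mk fun j => 1 / ((2 * j + 2).factorial : ℝ) := by
    ext n
    rw [e2, e4, map_add, PowerSeries.coeff_C_mul, PowerSeries.coeff_C_mul, hX, sinhTail,
      PowerSeries.coeff_mk, PowerSeries.coeff_mk, Nat.factorial_succ (2 * n + 2)]
    push_cast
    field_simp
    ring
  rw [e5, e1, e2, e3, map_add, PowerSeries.coeff_C_mul, PowerSeries.coeff_C_mul, hX,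
    PowerSeries.coeff_C_mul, PowerSeries.coeff_mul] at h
  simp only [PowerSeries.coeff_mk] at h
  rw [← h]; ring

/-- After division by factorials, the binomial recurrence is the Cauchy product of F^l with cosh x -
1, hence the derivative rule above. -/
theorem riordanA_add (l j : ℕ) :
    (riordanA (l + j) l : ℝ) * l.factorial =
      (3 * l + 2 * j).factorial * PowerSeries.coeff j (sinhTail ^ l) := by
  induction l generalizing j with
  | zero =>
    rw [riordanA]
    rcases j with _ | j
    · simp
    · simp [PowerSeries.coeff_one]
  | succ l ih =>
    have key : (riordanA (l + 1 + j) (l + 1) : ℝ) * l.factorial = (3 * l + 2 * j + 2).factorial *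
        ∑ p ∈ Finset.HasAntidiagonal.antidiagonal j, PowerSeries.coeff p.1 (sinhTail ^ l) *
        (1 / ((2 * p.2 + 2).factorial : ℝ)) := by
      rw [riordanA, Finset.sum_Ico_eq_sum_range, show l + 1 + j - l = j + 1 by omega,
        Finset.Nat.sum_antidiagonal_eq_sum_range_succ_mk]
      push_cast
      rw [Finset.sum_mul, Finset.mul_sum]
      refine Finset.sum_congr rfl fun i hi => ?_
      have hi' : i ≤ j := by simpa [Nat.lt_succ_iff] using hi
      obtain ⟨d, rfl⟩ := Nat.exists_eq_add_of_le hi'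
      rw [show 2 * (l + 1 + (i + d)) + l = (3 * l + 2 * i) + (2 * d + 2) by omega,
        show 2 * (l + 1 + (i + d)) - 2 * (l + i) = 2 * d + 2 by omega,
        show i + d - i = d by omega, ← Nat.choose_symm_add, Nat.cast_add_choose, mul_right_comm, ih,
        show 3 * l + 2 * (i + d) + 2 = (3 * l + 2 * i) + (2 * d + 2) by omega]
      field_simp
    have h2 := coeff_sinhTail_pow_succ l j
    rw [show 3 * (l + 1) + 2 * j = (3 * l + 2 * j + 2) + 1 by ring, Nat.factorial_succ (3 * l + 2 * j + 2),
      Nat.factorial_succ l]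
    push_cast
    linear_combination ((l : ℝ) + 1) * key - ((3 * l + 2 * j + 2).factorial : ℝ) * h2

theorem bernoulliP_eq (N j : ℕ) (hN : 1 ≤ N) :
    (bernoulliP (j + 1) (N + j) : ℝ) =
      6 ^ (N + j) * PowerSeries.coeff j (sinhTail ^ N) / N := by
  have h := riordanA_add N j
  rw [bernoulliP, show N + j + 1 - (j + 1) = N by omega]
  push_cast
  rw [Nat.cast_add_choose, show 2 * (N + j) + N = 3 * N + 2 * j by ring]
  have : (N : ℝ) ≠ 0 := by positivity
  field_simp
  linear_combination h

/-! ### Positivity and evaluation of the power series -/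

theorem coeff_sinhTail_pow_nonneg (N j : ℕ) : 0 ≤ PowerSeries.coeff j (sinhTail ^ N) := by
  induction N generalizing j with
  | zero => rw [pow_zero, PowerSeries.coeff_one]; split_ifs <;> norm_num
  | succ N ih =>
    rw [pow_succ, PowerSeries.coeff_mul]
    refine Finset.sum_nonneg fun p _ => mul_nonneg (ih _) ?_
    rw [sinhTail, PowerSeries.coeff_mk]; positivity

theorem summable_norm_sinhTail (x : ℝ) :
    Summable fun j : ℕ => ‖1 / ((2 * j + 3).factorial : ℝ) * x ^ j‖ := by
  refine Summable.of_nonneg_of_le (fun _ => norm_nonneg _) (fun j => ?_)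
    (Real.summable_pow_div_factorial |x|)
  rw [norm_mul, norm_pow, Real.norm_eq_abs, Real.norm_eq_abs, abs_of_nonneg (by positivity),
    one_div_mul_eq_div]
  gcongr
  omega

/-- The sum of the series `∑ x ^ j / (2 j + 3)!`. -/
noncomputable def sinhTailSum (x : ℝ) : ℝ := ∑' j : ℕ, 1 / ((2 * j + 3).factorial : ℝ) * x ^ j

theorem hasSum_sinhTail_pow (x : ℝ) (N : ℕ) :
    (Summable fun j => ‖PowerSeries.coeff j (sinhTail ^ N) * x ^ j‖) ∧
    HasSum (fun j => PowerSeries.coeff j (sinhTail ^ N) * x ^ j) (sinhTailSum x ^ N) := by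
  induction N with
  | zero =>
    have h0 : ∀ j, j ≠ 0 → PowerSeries.coeff j (sinhTail ^ 0) * x ^ j = 0 := by
      intro j hj; simp [PowerSeries.coeff_one, hj]
    constructor
    · exact (hasSum_single 0 fun j hj => by rw [h0 j hj, norm_zero]).summable
    · convert hasSum_single 0 h0 using 1
      simp
  | succ N ih =>
    have e : ∀ j, PowerSeries.coeff j (sinhTail ^ (N + 1)) * x ^ j =
        ∑ p ∈ Finset.HasAntidiagonal.antidiagonal j, (PowerSeries.coeff p.1 (sinhTail ^ N) * x ^ p.1) *
          (1 / ((2 * p.2 + 3).factorial : ℝ) * x ^ p.2) := by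
      intro j
      rw [pow_succ, PowerSeries.coeff_mul, Finset.sum_mul]
      refine Finset.sum_congr rfl fun p hp => ?_
      rw [← Finset.HasAntidiagonal.mem_antidiagonal.1 hp, pow_add, sinhTail, PowerSeries.coeff_mk]
      ring
    simp only [e]
    have hs := summable_norm_sum_mul_antidiagonal_of_summable_norm ih.1 (summable_norm_sinhTail x)
    refine ⟨hs, ?_⟩
    rw [pow_succ, ← ih.2.tsum_eq, sinhTailSum,
      tsum_mul_tsum_eq_tsum_sum_antidiagonal_of_summable_norm ih.1 (summable_norm_sinhTail x)]
    exact hs.of_norm.hasSum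

theorem sinhTailSum_nonneg {x : ℝ} (hx : 0 ≤ x) : 0 ≤ sinhTailSum x :=
  tsum_nonneg fun _ => by positivity

/-- Since 6 · j! ≤ (2j+3)!, comparison with the exponential series gives S(x) ≤ e/6 < 1. This is the
ratio that makes the double series converge absolutely. -/
theorem mul_sinhTailSum_lt_one {x : ℝ} (hx : 0 ≤ x) (hx1 : x ≤ 1) : x * sinhTailSum x < 1 := by
  have h1 : sinhTailSum x ≤ Real.exp 1 / 6 := by
    rw [sinhTailSum, Real.exp_eq_exp_ℝ, NormedSpace.exp_eq_tsum_div, ← tsum_div_const]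
    refine (summable_norm_sinhTail x).of_norm.tsum_le_tsum (fun j => ?_)
      ((Real.summable_pow_div_factorial 1).div_const 6)
    have hf : 6 * j.factorial ≤ (2 * j + 3).factorial :=
      calc 6 * j.factorial = Nat.factorial 3 * j.factorial := rfl
        _ ≤ (3 + j).factorial := Nat.le_of_dvd (Nat.factorial_pos _)
          (Nat.factorial_mul_factorial_dvd_factorial_add 3 j)
        _ ≤ _ := Nat.factorial_le (by omega)
    have hf' : (6 * j.factorial : ℝ) ≤ (2 * j + 3).factorial := by exact_mod_cast hf
    calc 1 / ((2 * j + 3).factorial : ℝ) * x ^ j ≤ 1 / (6 * j.factorial : ℝ) * 1 := by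
          gcongr
          exact pow_le_one₀ hx hx1
      _ = _ := by rw [one_pow]; field_simp
  have h2 := Real.exp_one_lt_d9
  have h3 := sinhTailSum_nonneg hx
  nlinarith

/-- A negative argument turns the sinh tail into the sine tail; the alternating signs in the theorem
enter here. -/
theorem neg_sq_mul_sinhTailSum (w : ℝ) (hw : w ≠ 0) :
    -w ^ 2 * sinhTailSum (-w ^ 2) = Real.sin w / w - 1 := by
  have h1 := (hasSum_nat_add_iff' 1).2 (Real.hasSum_sin w)
  have h2 := (summable_norm_sinhTail (-w ^ 2)).of_norm.hasSum.mul_left (-w ^ 3)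
  have e : (fun j : ℕ => -w ^ 3 * (1 / ((2 * j + 3).factorial : ℝ) * (-w ^ 2) ^ j)) =
      fun j : ℕ => (-1) ^ (j + 1) * w ^ (2 * (j + 1) + 1) /
        ((2 * (j + 1) + 1).factorial : ℝ) := by
    ext j
    rw [show 2 * (j + 1) + 1 = 2 * j + 3 by ring, neg_pow (w ^ 2) j]
    ring
  rw [e] at h2
  have h3 := h2.unique h1
  change -w ^ 3 * sinhTailSum (-w ^ 2) = _ at h3
  simp at h3
  field_simp
  linear_combination h3

/-! ### Fourier series of log(2 sin(θ/2)) by Abel summation -/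

theorem HasSum.of_eq {ι : Type*} {f g : ι → ℝ} {a b : ℝ} (h : HasSum f a) (hf : ∀ i, f i = g i)
    (ha : a = b) : HasSum g b := by
  obtain rfl : f = g := funext hf
  exact ha ▸ h

open Real in
-- Real part of -log(1 - z) at z = r e^(iθ).
theorem hasSum_pow_mul_cos_div {r : ℝ} (hr0 : 0 ≤ r) (hr1 : r < 1) (θ : ℝ) :
    HasSum (fun n : ℕ => r ^ (n + 1) * cos ((n + 1) * θ) / (n + 1))
      (-(1 / 2) * log (1 - 2 * r * cos θ + r ^ 2)) := by
  have hz : ‖(r : ℂ) * Complex.exp (θ * Complex.I)‖ < 1 := by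
    rw [norm_mul, Complex.norm_exp_ofReal_mul_I, mul_one, Complex.norm_real, norm_of_nonneg hr0]
    exact hr1
  have h := Complex.hasSum_re (Complex.hasSum_taylorSeries_neg_log' hz)
  have e : (fun n : ℕ => r ^ (n + 1) * cos ((n + 1) * θ) / (n + 1)) = fun n : ℕ =>
      (((r : ℂ) * Complex.exp (θ * Complex.I)) ^ (n + 1) / (n + 1)).re := by
    ext n
    rw [mul_pow, ← Complex.exp_nat_mul, ← mul_assoc, ← Complex.ofReal_natCast,
      ← Complex.ofReal_mul, ← Complex.ofReal_pow,
      show ((n : ℂ) + 1) = (((n + 1 : ℕ) : ℝ) : ℂ) by push_cast; rfl, Complex.div_ofReal_re,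
      Complex.re_ofReal_mul, Complex.exp_ofReal_mul_I_re]
    push_cast
    rfl
  rw [e]
  convert h using 1
  rw [Complex.neg_re, Complex.log_re, ← Real.sqrt_sq (norm_nonneg _), Complex.sq_norm,
    Real.log_sqrt (Complex.normSq_nonneg _), Complex.normSq_apply]
  have h1 : (1 - (r : ℂ) * Complex.exp (θ * Complex.I)).re = 1 - r * cos θ := by
    rw [Complex.sub_re, Complex.re_ofReal_mul, Complex.exp_ofReal_mul_I_re, Complex.one_re]
  have h2 : (1 - (r : ℂ) * Complex.exp (θ * Complex.I)).im = - (r * sin θ) := by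
    rw [Complex.sub_im, Complex.im_ofReal_mul, Complex.exp_ofReal_mul_I_im, Complex.one_im,
      zero_sub]
  rw [h1, h2, show (1 - r * cos θ) * (1 - r * cos θ) + -(r * sin θ) * -(r * sin θ) =
    1 - 2 * r * cos θ + r ^ 2 by linear_combination r ^ 2 * sin_sq_add_cos_sq θ]
  ring

open Real in
theorem integral_one_sub_mul_cos {c : ℝ} (hc : c ≠ 0) :
    ∫ v in (0 : ℝ)..1, (1 - v) * cos (c * v) = (1 - cos c) / c ^ 2 := by
  have h : ∀ v ∈ Set.uIcc (0 : ℝ) 1, HasDerivAt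
      (fun v => (1 - v) * (sin (c * v) / c) - cos (c * v) / c ^ 2) ((1 - v) * cos (c * v)) v := by
    intro v _
    have h0 : HasDerivAt (fun v : ℝ => c * v) c v := by
      simpa using (hasDerivAt_id v).const_mul c
    have h1 := (((hasDerivAt_id v).const_sub 1).mul (h0.sin.div_const c)).sub
      (h0.cos.div_const (c ^ 2))
    refine h1.congr_deriv ?_
    simp
    field_simp
    ring
  rw [intervalIntegral.integral_eq_sub_of_hasDerivAt h
    (Continuous.intervalIntegrable (by fun_prop) _ _)]
  simp
  ring

open Real in
theorem hasSum_pow_mul_one_sub_cos {r : ℝ} (hr0 : 0 ≤ r) (hr1 : r < 1) {α : ℝ} (hα : α ≠ 0) :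
    HasSum (fun n : ℕ => r ^ (n + 1) / (n + 1) * ((1 - cos ((n + 1) * α)) / ((n + 1) * α) ^ 2))
      (∫ v in (0 : ℝ)..1, (1 - v) * (-(1 / 2) * log (1 - 2 * r * cos (α * v) + r ^ 2))) := by
  have key := intervalIntegral.hasSum_integral_of_dominated_convergence
    (μ := MeasureTheory.volume) (a := 0) (b := 1)
    (F := fun (n : ℕ) v => (1 - v) * (r ^ (n + 1) * cos ((n + 1) * (α * v)) / (n + 1)))
    (f := fun v => (1 - v) * (-(1 / 2) * log (1 - 2 * r * cos (α * v) + r ^ 2)))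
    (fun n _ => r ^ n) (fun n => Continuous.aestronglyMeasurable (by fun_prop)) ?_ ?_ ?_ ?_
  · refine key.of_eq (fun n => ?_) rfl
    rw [← integral_one_sub_mul_cos (mul_ne_zero (by positivity) hα),
      ← intervalIntegral.integral_const_mul]
    congr 1
    ext v
    rw [mul_assoc ((n : ℝ) + 1) α v]
    ring
  · intro n
    refine Filter.Eventually.of_forall fun v hv => ?_
    rw [Set.uIoc_of_le zero_le_one] at hv
    rw [norm_mul, norm_div, norm_mul, norm_of_nonneg (by linarith [hv.2] : (0 : ℝ) ≤ 1 - v),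
      norm_of_nonneg (by positivity : (0 : ℝ) ≤ r ^ (n + 1)),
      norm_of_nonneg (by positivity : (0 : ℝ) ≤ (n : ℝ) + 1), norm_eq_abs]
    have h1 : r ^ (n + 1) ≤ r ^ n := pow_le_pow_of_le_one hr0 hr1.le (Nat.le_succ n)
    have h2 : 1 - v ≤ 1 := by linarith [hv.1]
    calc (1 - v) * (r ^ (n + 1) * |cos ((n + 1) * (α * v))| / (n + 1))
        ≤ 1 * (r ^ (n + 1) * 1 / 1) := by
          gcongr
          · exact abs_cos_le_one _
          · linarith [(Nat.cast_nonneg n : (0 : ℝ) ≤ n)]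
      _ ≤ _ := by simpa using h1
  · exact Filter.Eventually.of_forall fun v _ => summable_geometric_of_lt_one hr0 hr1
  · exact intervalIntegrable_const
  · exact Filter.Eventually.of_forall fun v _ =>
      (hasSum_pow_mul_cos_div hr0 hr1 (α * v)).mul_left (1 - v)

open Real in
-- The argument equals (r - cos θ)² + sin² θ, so it lies between sin² θ and 4. The bound is free of
-- r and integrable in θ, as dominated convergence for r → 1 requires.
theorem abs_log_one_sub_two_mul_cos_le {r θ : ℝ} (hr0 : 0 ≤ r) (hr1 : r < 1) (hθ : sin θ ≠ 0) :
    |log (1 - 2 * r * cos θ + r ^ 2)| ≤ log 4 + 2 * |log (sin θ)| := by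
  have h1 : sin θ ^ 2 ≤ 1 - 2 * r * cos θ + r ^ 2 := by
    nlinarith [sin_sq_add_cos_sq θ, sq_nonneg (r - cos θ)]
  have h0 : 0 < sin θ ^ 2 := by positivity
  have h2 : 1 - 2 * r * cos θ + r ^ 2 ≤ 4 := by nlinarith [neg_one_le_cos θ]
  have h3 := log_le_log h0 h1
  have h4 := log_le_log (h0.trans_le h1) h2
  rw [log_pow] at h3
  push_cast at h3
  have h5 := neg_abs_le (log (sin θ))
  have h6 := abs_nonneg (log (sin θ))
  have h7 : 0 ≤ log 4 := log_nonneg (by norm_num)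
  rw [abs_le]
  constructor <;> linarith

open Real in
-- Limit r → 1⁻ of the integrated series with α = π/3: the series is dominated by 2/n³, the integral
-- by a multiple-free |log sin| bound, and 2 - 2 cos θ = (2 sin(θ/2))².
theorem hasSum_one_sub_cos_div_cube :
    HasSum (fun n : ℕ => (1 - cos ((n + 1) * (π / 3))) / ((n : ℝ) + 1) ^ 3)
      (-(π ^ 2 / 9) * ∫ v in (0 : ℝ)..1, (1 - v) * log (2 * sin (π / 6 * v))) := by
  have hπ := pi_pos
  have hsum : Summable (fun n : ℕ => 2 * (1 / ((n : ℝ) + 1) ^ 3)) :=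
    (((summable_nat_add_iff 1).2 (Real.summable_one_div_nat_pow.2 (by norm_num : 1 < 3))).congr
      fun n => by push_cast; rfl).mul_left 2
  have hb : ∀ n : ℕ, ‖(1 - cos ((n + 1) * (π / 3))) / ((n : ℝ) + 1) ^ 3‖ ≤
      2 * (1 / ((n : ℝ) + 1) ^ 3) := by
    intro n
    rw [norm_div, norm_eq_abs, norm_of_nonneg (by positivity : (0 : ℝ) ≤ ((n : ℝ) + 1) ^ 3),
      mul_one_div]
    gcongr
    rw [abs_le]
    constructor <;> linarith [neg_one_le_cos ((n + 1) * (π / 3)), cos_le_one ((n + 1) * (π / 3))]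
  have hs := Summable.of_norm_bounded hsum hb
  have hev : ∀ᶠ r : ℝ in nhdsWithin 1 (Set.Iio 1), 0 ≤ r ∧ r < 1 := by
    filter_upwards [self_mem_nhdsWithin, mem_nhdsWithin_of_mem_nhds (Ioi_mem_nhds zero_lt_one)]
      with r h1 h2
    exact ⟨le_of_lt h2, h1⟩
  have hsin : ∀ v ∈ Set.Ioc (0 : ℝ) 1, sin (π / 3 * v) ≠ 0 := fun v hv =>
    (sin_pos_of_pos_of_lt_pi (by have := hv.1; positivity) (by nlinarith [hv.2])).ne'
  have hsin2 : ∀ v ∈ Set.Ioc (0 : ℝ) 1, 0 < sin (π / 6 * v) := fun v hv =>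
    sin_pos_of_pos_of_lt_pi (by have := hv.1; positivity) (by nlinarith [hv.2])
  have hL : Filter.Tendsto (fun r : ℝ => ∑' n : ℕ,
      r ^ (n + 1) * ((1 - cos ((n + 1) * (π / 3))) / ((n : ℝ) + 1) ^ 3))
      (nhdsWithin 1 (Set.Iio 1))
      (nhds (∑' n : ℕ, (1 - cos ((n + 1) * (π / 3))) / ((n : ℝ) + 1) ^ 3)) := by
    refine tendsto_tsum_of_dominated_convergence hsum (fun n => ?_) ?_
    · have hc : Continuous fun r : ℝ =>
          r ^ (n + 1) * ((1 - cos ((n + 1) * (π / 3))) / ((n : ℝ) + 1) ^ 3) := by fun_prop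
      have := hc.tendsto 1
      rw [one_pow, one_mul] at this
      exact this.mono_left nhdsWithin_le_nhds
    · filter_upwards [hev] with r hr n
      rw [norm_mul, norm_of_nonneg (by have := hr.1; positivity : (0 : ℝ) ≤ r ^ (n + 1))]
      exact (mul_le_of_le_one_left (norm_nonneg _) (pow_le_one₀ hr.1 hr.2.le)).trans (hb n)
  have hR : Filter.Tendsto (fun r : ℝ => ∫ v in (0 : ℝ)..1,
      (1 - v) * (-(1 / 2) * log (1 - 2 * r * cos (π / 3 * v) + r ^ 2)))
      (nhdsWithin 1 (Set.Iio 1))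
      (nhds (∫ v in (0 : ℝ)..1, (1 - v) * (- log (2 * sin (π / 6 * v))))) := by
    refine intervalIntegral.tendsto_integral_filter_of_dominated_convergence
      (fun v => log 4 + |log (sin (π / 3 * v))|) ?_ ?_ ?_ ?_
    · refine Filter.Eventually.of_forall fun r => ?_
      exact (Measurable.aestronglyMeasurable (by fun_prop))
    · filter_upwards [hev] with r hr
      refine Filter.Eventually.of_forall fun v hv => ?_
      rw [Set.uIoc_of_le zero_le_one] at hv
      have := abs_log_one_sub_two_mul_cos_le hr.1 hr.2 (hsin v hv)
      rw [norm_mul, norm_mul, norm_of_nonneg (by linarith [hv.2] : (0 : ℝ) ≤ 1 - v), norm_eq_abs,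
        norm_eq_abs, show |-(1 / 2 : ℝ)| = 1 / 2 by rw [abs_neg, abs_of_pos (by norm_num)]]
      have h7 : 0 ≤ log 4 := log_nonneg (by norm_num)
      have h8 : (1 - v) * (1 / 2 * |log (1 - 2 * r * cos (π / 3 * v) + r ^ 2)|) ≤
          1 * (1 / 2 * |log (1 - 2 * r * cos (π / 3 * v) + r ^ 2)|) := by
        gcongr
        linarith [hv.1]
      linarith
    · refine intervalIntegrable_const.add (IntervalIntegrable.abs ?_)
      have := (intervalIntegrable_log_sin (a := π / 3 * 0) (b := π / 3 * 1)).comp_mul_left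
        (c := π / 3)
      simpa using this
    · refine Filter.Eventually.of_forall fun v hv => ?_
      rw [Set.uIoc_of_le zero_le_one] at hv
      have hs2 := hsin2 v hv
      have e : 1 - 2 * 1 * cos (π / 3 * v) + 1 ^ 2 = (2 * sin (π / 6 * v)) ^ 2 := by
        rw [show π / 3 * v = 2 * (π / 6 * v) by ring, cos_two_mul, cos_sq']
        ring
      have hc : ContinuousAt (fun r : ℝ =>
          (1 - v) * (-(1 / 2) * log (1 - 2 * r * cos (π / 3 * v) + r ^ 2))) 1 := by
        refine continuousAt_const.mul (continuousAt_const.mul (ContinuousAt.log (by fun_prop) ?_))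
        rw [e]
        positivity
      have ht := hc.tendsto
      rw [e, log_pow] at ht
      convert ht.mono_left nhdsWithin_le_nhds using 2
      push_cast
      ring
  have hE : (∫ v in (0 : ℝ)..1, (1 - v) * (- log (2 * sin (π / 6 * v)))) * (π / 3) ^ 2 =
      ∑' n : ℕ, (1 - cos ((n + 1) * (π / 3))) / ((n : ℝ) + 1) ^ 3 := by
    refine tendsto_nhds_unique (hR.mul_const ((π / 3) ^ 2)) (hL.congr' ?_)
    filter_upwards [hev] with r hr
    rw [← (hasSum_pow_mul_one_sub_cos hr.1 hr.2 (by positivity : π / 3 ≠ 0)).tsum_eq,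
      ← tsum_mul_right]
    refine tsum_congr fun n => ?_
    field_simp
  refine hs.hasSum.of_eq (fun _ => rfl) ?_
  rw [← hE]
  simp only [mul_neg, intervalIntegral.integral_neg]
  ring

/-! ### The cosine sum at π/3 as a multiple of ζ(3) -/

theorem hasSum_ite_dvd_div_cube {Z : ℝ} (hZ : HasSum (fun n : ℕ => 1 / (n : ℝ) ^ 3) Z) {d : ℕ}
    (hd : 0 < d) :
    HasSum (fun n : ℕ => if d ∣ n then 1 / (n : ℝ) ^ 3 else 0) (Z / d ^ 3) := by
  have hinj : Function.Injective fun n : ℕ => d * n := fun a b h => Nat.eq_of_mul_eq_mul_left hd h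
  refine (hinj.hasSum_iff ?_).1 ?_
  · intro n hn
    rw [if_neg]
    rintro ⟨m, rfl⟩
    exact hn ⟨m, rfl⟩
  · refine (hZ.div_const ((d : ℝ) ^ 3)).of_eq (fun n => ?_) rfl
    simp only [Function.comp, dvd_mul_right, if_true]
    push_cast
    rw [mul_pow, div_div, mul_comm]

open Real in
theorem cos_nat_mul_pi_div_three (n : ℕ) :
    cos (n * (π / 3)) = 1 / 2 - (if 2 ∣ n then 1 else 0) - 3 / 2 * (if 3 ∣ n then 1 else 0) +
      3 * (if 6 ∣ n then 1 else 0) := by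
  have h2 : cos (2 * (π / 3)) = -(1 / 2) := by
    rw [cos_two_mul, cos_pi_div_three]; norm_num
  have h4 : cos (4 * (π / 3)) = -(1 / 2) := by
    rw [show 4 * (π / 3) = π / 3 + π by ring, cos_add_pi, cos_pi_div_three]
  have h5 : cos (5 * (π / 3)) = 1 / 2 := by
    rw [show 5 * (π / 3) = 2 * π - π / 3 by ring, cos_two_pi_sub, cos_pi_div_three]
  have h3 : cos (3 * (π / 3)) = -1 := by
    rw [show 3 * (π / 3) = π by ring, cos_pi]
  have hmod : n = 6 * (n / 6) + n % 6 := (Nat.div_add_mod n 6).symm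
  have hlt : n % 6 < 6 := Nat.mod_lt _ (by norm_num)
  have hc : cos (n * (π / 3)) = cos ((n % 6 : ℕ) * (π / 3)) := by
    rw [← cos_add_nat_mul_two_pi ((n % 6 : ℕ) * (π / 3)) (n / 6)]
    congr 1
    have : (n : ℝ) * (π / 3) = (6 * (n / 6 : ℕ) + (n % 6 : ℕ)) * (π / 3) := by
      congr 1
      exact_mod_cast hmod
    rw [this]
    ring
  have d2 : 2 ∣ n ↔ 2 ∣ n % 6 := by omega
  have d3 : 3 ∣ n ↔ 3 ∣ n % 6 := by omega
  have d6 : 6 ∣ n ↔ 6 ∣ n % 6 := by omega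
  rw [hc]
  simp only [d2, d3, d6]
  generalize n % 6 = m at hlt
  interval_cases m <;> norm_num [h2, h3, h4, h5]

open Real in
-- The divisibility indicators for 2, 3, 6 contribute 1/2 - 1/8 - (3/2)/27 + 3/216 = 1/3.
theorem hasSum_cos_nat_mul_pi_div_three {Z : ℝ} (hZ : HasSum (fun n : ℕ => 1 / (n : ℝ) ^ 3) Z) :
    HasSum (fun n : ℕ => cos (n * (π / 3)) / (n : ℝ) ^ 3) (Z / 3) := by
  have h := (((hZ.mul_left (1 / 2)).sub (hasSum_ite_dvd_div_cube hZ (d := 2) (by norm_num))).sub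
    ((hasSum_ite_dvd_div_cube hZ (d := 3) (by norm_num)).mul_left (3 / 2))).add
    ((hasSum_ite_dvd_div_cube hZ (d := 6) (by norm_num)).mul_left 3)
  refine h.of_eq (fun n => ?_) ?_
  · rw [cos_nat_mul_pi_div_three]
    split_ifs <;> ring
  · push_cast
    ring

theorem exists_hasSum_riemannZeta_three :
    ∃ Z : ℝ, riemannZeta 3 = (Z : ℂ) ∧ HasSum (fun n : ℕ => 1 / (n : ℝ) ^ 3) Z := by
  have hs : Summable fun n : ℕ => 1 / (n : ℝ) ^ 3 :=
    Real.summable_one_div_nat_pow.2 (by norm_num)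
  refine ⟨_, ?_, hs.hasSum⟩
  have := zeta_nat_eq_tsum_of_gt_one (k := 3) (by norm_num)
  rw [Complex.ofReal_tsum]
  push_cast at this ⊢
  exact this

open Real in
theorem integral_one_sub_mul_log_two_mul_sin {Z : ℝ}
    (hZ : HasSum (fun n : ℕ => 1 / (n : ℝ) ^ 3) Z) :
    ∫ v in (0 : ℝ)..1, (1 - v) * log (2 * sin (π / 6 * v)) = -6 * Z / π ^ 2 := by
  have h := hZ.sub (hasSum_cos_nat_mul_pi_div_three hZ)
  -- The removed term n = 0 is zero, because division by zero gives 0.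
  have h1 := (hasSum_nat_add_iff' 1).2 h
  have h2 := hasSum_one_sub_cos_div_cube
  have h3 := h2.unique (h1.of_eq (fun n => by push_cast; ring) rfl)
  simp only [Finset.sum_range_one, Nat.cast_zero] at h3
  rw [eq_div_iff (by positivity)]
  linear_combination -9 * h3

/-! ### Integration by parts and the closed form of the integral -/

open Real in
theorem integral_one_sub_mul_log : ∫ v in (0 : ℝ)..1, (1 - v) * log v = -3 / 4 := by
  have h := intervalIntegral.integral_eq_sub_of_hasDerivAt_of_le (a := 0) (b := 1)
    (f := fun v : ℝ => v * log v - v - (v * (v * log v) / 2 - v ^ 2 / 4))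
    (f' := fun v => (1 - v) * log v) zero_le_one
    (by have := continuous_mul_log; exact Continuous.continuousOn (by fun_prop)) ?_ ?_
  · rw [h]; norm_num
  · intro v hv
    have hv0 : v ≠ 0 := hv.1.ne'
    have h1 := hasDerivAt_mul_log hv0
    have h2 := (h1.sub (hasDerivAt_id v)).sub
      ((((hasDerivAt_id v).mul h1).div_const 2).sub ((hasDerivAt_pow 2 v).div_const 4))
    refine h2.congr_deriv ?_
    simp
    ring
  · exact intervalIntegral.intervalIntegrable_log'.continuousOn_mul (by fun_prop)

open Real in
-- Shows that cot w - 1/w → 0, which kills the cotangent boundary term at v = 0.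
theorem abs_cos_div_sin_sub_inv_le {w : ℝ} (h0 : 0 < w) (h1 : w ≤ 1) :
    |cos w / sin w - 1 / w| ≤ w := by
  have hs := sin_gt_sub_cube h0
  have hs1 : w / 2 < sin w := by nlinarith [mul_pos h0 h0]
  have hs0 : 0 < sin w := by linarith
  have hs2 := sin_lt h0
  have hc := one_sub_sq_div_two_le_cos (x := w)
  have hc1 := cos_le_one w
  have hup : w * cos w ≤ sin w := by
    have := le_tan h0.le (by linarith [pi_gt_three])
    rw [tan_eq_sin_div_cos, le_div_iff₀ (cos_pos_of_mem_Ioo ⟨by linarith [pi_gt_three],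
      by linarith [pi_gt_three]⟩)] at this
    exact this
  rw [show cos w / sin w - 1 / w = -((sin w - w * cos w) / (sin w * w)) by field_simp; ring,
    abs_neg, abs_of_nonneg (by apply div_nonneg <;> nlinarith), div_le_iff₀ (by positivity)]
  nlinarith [mul_pos h0 h0, mul_pos h0 (sub_pos.2 hs1)]

open Real Filter in
theorem tendsto_sin_mul_div (y : ℝ) :
    Tendsto (fun v => sin (v * y) / v) (nhdsWithin 0 (Set.Ioi 0)) (nhds y) := by
  have h0 : HasDerivAt (fun v : ℝ => sin (v * y)) y 0 := by
    simpa using ((hasDerivAt_id (0 : ℝ)).mul_const y).sin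
  have := h0.tendsto_slope.mono_left
    (nhdsWithin_mono 0 (fun x (hx : 0 < x) => hx.ne') : nhdsWithin (0 : ℝ) (Set.Ioi 0) ≤ _)
  refine this.congr fun v => ?_
  simp [slope_def_field]

open Real Filter in
-- Two integrations by parts, through -y(cot(vy) - 1/(vy)) and then log(sin(vy)/v). Subtracting 1/v²
-- removes the pole at 0, and the only surviving boundary term comes from sin(vy)/v → y.
-- Integrability is assumed here and supplied later by the double series.
theorem integral_one_sub_pow_mul_sin_inv_sq {y : ℝ} (hy : 0 < y) (hy1 : y ≤ 1)
    (hint : IntervalIntegrable (fun v => (1 - v) ^ 3 * (y ^ 2 / sin (v * y) ^ 2 - 1 / v ^ 2))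
      MeasureTheory.volume 0 1) :
    ∫ v in (0 : ℝ)..1, (1 - v) ^ 3 * (y ^ 2 / sin (v * y) ^ 2 - 1 / v ^ 2) =
      3 * log y - 6 * ∫ v in (0 : ℝ)..1, (1 - v) * (log (sin (v * y)) - log v) := by
  have hsin : ∀ v ∈ Set.Ioc (0 : ℝ) 1, 0 < sin (v * y) := fun v hv =>
    sin_pos_of_pos_of_lt_pi (mul_pos hv.1 hy) (by nlinarith [hv.1, hv.2, pi_gt_three])
  have hq : IntervalIntegrable (fun v => (1 - v) * (log (sin (v * y)) - log v))
      MeasureTheory.volume 0 1 := by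
    refine IntervalIntegrable.continuousOn_mul (IntervalIntegrable.sub ?_
      intervalIntegral.intervalIntegrable_log') (by fun_prop)
    have := (intervalIntegrable_log_sin (a := 0 * y) (b := 1 * y)).comp_mul_right (c := y)
    simpa [hy.ne'] using this
  have hd : ∀ v ∈ Set.Ioc (0 : ℝ) 1, HasDerivAt (fun v =>
      -(1 - v) ^ 3 * (y * (cos (v * y) / sin (v * y) - 1 / (v * y))) -
        3 * (1 - v) ^ 2 * log (sin (v * y) / v))
      ((1 - v) ^ 3 * (y ^ 2 / sin (v * y) ^ 2 - 1 / v ^ 2) +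
        6 * ((1 - v) * (log (sin (v * y)) - log v))) v := by
    intro v hv
    have hv0 : v ≠ 0 := hv.1.ne'
    have hs := (hsin v hv).ne'
    have hm : HasDerivAt (fun v : ℝ => v * y) y v := by
      simpa using (hasDerivAt_id v).mul_const y
    have h1 := (hasDerivAt_id v).const_sub 1
    have h2 := ((hm.cos.div hm.sin hs).sub ((hasDerivAt_const v (1 : ℝ)).div hm
      (mul_ne_zero hv0 hy.ne'))).const_mul y
    have h3 := ((hm.sin.div (hasDerivAt_id v) hv0).log (div_ne_zero hs hv0))
    have h4 := ((h1.pow 3).neg.mul h2).sub (((h1.pow 2).const_mul 3).mul h3)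
    refine h4.congr_deriv ?_
    have hl : log (sin (v * y) / v) = log (sin (v * y)) - log v := log_div hs hv0
    have hcs : cos (v * y) ^ 2 = 1 - sin (v * y) ^ 2 := cos_sq' _
    simp [hl]
    generalize log (sin (v * y)) = A
    generalize log v = B
    generalize sin (v * y) = S at *
    generalize cos (v * y) = C at *
    field_simp
    ring_nf
    rw [hcs]
    ring
  have h := intervalIntegral.integral_eq_sub_of_hasDerivAt_of_tendsto zero_lt_one
    (fun v hv => hd v (Set.Ioo_subset_Ioc_self hv)) (hint.add (hq.const_mul 6))
    (fa := -3 * log y) (fb := 0) ?_ ?_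
  · rw [intervalIntegral.integral_add hint (hq.const_mul 6),
      intervalIntegral.integral_const_mul] at h
    linarith
  · have h1 : Tendsto (fun v => cos (v * y) / sin (v * y) - 1 / (v * y))
        (nhdsWithin 0 (Set.Ioi 0)) (nhds 0) := by
      refine squeeze_zero_norm' (a := fun v => v * y) ?_ ?_
      · filter_upwards [Ioc_mem_nhdsGT zero_lt_one] with v hv
        exact abs_cos_div_sin_sub_inv_le (mul_pos hv.1 hy) (by nlinarith [hv.1, hv.2])
      · have : Continuous fun v : ℝ => v * y := by fun_prop
        simpa using (this.tendsto 0).mono_left (nhdsWithin_le_nhds (s := Set.Ioi 0))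
    have h2 : Tendsto (fun v => log (sin (v * y) / v)) (nhdsWithin 0 (Set.Ioi 0))
        (nhds (log y)) := (tendsto_sin_mul_div y).log hy.ne'
    have h3 : Tendsto (fun v : ℝ => -(1 - v) ^ 3) (nhdsWithin 0 (Set.Ioi 0)) (nhds (-1)) := by
      have : Continuous fun v : ℝ => -(1 - v) ^ 3 := by fun_prop
      simpa using (this.tendsto 0).mono_left (nhdsWithin_le_nhds (s := Set.Ioi 0))
    have h4 : Tendsto (fun v : ℝ => 3 * (1 - v) ^ 2) (nhdsWithin 0 (Set.Ioi 0)) (nhds 3) := by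
      have : Continuous fun v : ℝ => 3 * (1 - v) ^ 2 := by fun_prop
      simpa using (this.tendsto 0).mono_left (nhdsWithin_le_nhds (s := Set.Ioi 0))
    have h5 := (h3.mul (h1.const_mul y)).sub (h4.mul h2)
    convert h5 using 2
    ring
  · have := (hd 1 ⟨zero_lt_one, le_rfl⟩).continuousAt.tendsto
    simp only [sub_self] at this
    convert this.mono_left (nhdsWithin_le_nhds (s := Set.Iio 1)) using 2
    ring

open Real in
theorem integral_one_sub_pow_mul_sin_inv_sq_pi_div_six {Z : ℝ}
    (hZ : HasSum (fun n : ℕ => 1 / (n : ℝ) ^ 3) Z)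
    (hint : IntervalIntegrable (fun v => (1 - v) ^ 3 *
      ((π / 6) ^ 2 / sin (v * (π / 6)) ^ 2 - 1 / v ^ 2)) MeasureTheory.volume 0 1) :
    ∫ v in (0 : ℝ)..1, (1 - v) ^ 3 * ((π / 6) ^ 2 / sin (v * (π / 6)) ^ 2 - 1 / v ^ 2) =
      3 * log (π / 3) + 36 * Z / π ^ 2 - 9 / 2 := by
  have hπ := pi_pos
  rw [integral_one_sub_pow_mul_sin_inv_sq (by positivity) (by linarith [pi_lt_four]) hint]
  have hA : IntervalIntegrable (fun v => (1 - v) * log (2 * sin (π / 6 * v)))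
      MeasureTheory.volume 0 1 := by
    refine IntervalIntegrable.continuousOn_mul ?_ (by fun_prop)
    have h := (intervalIntegrable_log_sin (a := π / 6 * 0) (b := π / 6 * 1)).comp_mul_left
      (c := π / 6)
    have h' : IntervalIntegrable (fun v => log 2 + log (sin (π / 6 * v)))
        MeasureTheory.volume 0 1 := by
      refine intervalIntegrable_const.add ?_
      simpa using h
    refine h'.congr fun v hv => ?_
    rw [Set.uIoc_of_le zero_le_one] at hv
    have : 0 < sin (π / 6 * v) :=
      sin_pos_of_pos_of_lt_pi (by have := hv.1; positivity) (by nlinarith [hv.2])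
    exact (log_mul two_ne_zero this.ne').symm
  have hB : IntervalIntegrable (fun v => (1 - v) * log v) MeasureTheory.volume 0 1 :=
    intervalIntegral.intervalIntegrable_log'.continuousOn_mul (by fun_prop)
  have hC : IntervalIntegrable (fun v : ℝ => (1 - v) * log 2) MeasureTheory.volume 0 1 :=
    Continuous.intervalIntegrable (by fun_prop) _ _
  have hC1 : ∫ v in (0 : ℝ)..1, (1 - v) * log 2 = log 2 / 2 := by
    rw [intervalIntegral.integral_mul_const, intervalIntegral.integral_sub
      intervalIntegrable_const intervalIntegral.intervalIntegrable_id, integral_id]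
    norm_num
    ring
  have hE : ∫ v in (0 : ℝ)..1, (1 - v) * (log (sin (v * (π / 6))) - log v) =
      ∫ v in (0 : ℝ)..1, ((1 - v) * log (2 * sin (π / 6 * v)) - (1 - v) * log 2 -
        (1 - v) * log v) := by
    refine intervalIntegral.integral_congr_ae (Filter.Eventually.of_forall fun v hv => ?_)
    rw [Set.uIoc_of_le zero_le_one] at hv
    have : 0 < sin (π / 6 * v) :=
      sin_pos_of_pos_of_lt_pi (by have := hv.1; positivity) (by nlinarith [hv.2])
    rw [log_mul two_ne_zero this.ne', mul_comm v]
    ring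
  rw [hE, intervalIntegral.integral_sub (hA.sub hC) hB, intervalIntegral.integral_sub hA hC,
    integral_one_sub_mul_log, hC1, integral_one_sub_mul_log_two_mul_sin hZ,
    show π / 3 = 2 * (π / 6) by ring, log_mul two_ne_zero (by positivity)]
  ring

/-! ### Double series for the integrand -/

theorem integral_one_sub_pow_three_mul_pow (n : ℕ) :
    ∫ v in (0 : ℝ)..1, (1 - v) ^ 3 * v ^ n =
      6 / (((n : ℝ) + 1) * (n + 2) * (n + 3) * (n + 4)) := by
  have h : ∀ v ∈ Set.uIcc (0 : ℝ) 1, HasDerivAt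
      (fun v : ℝ => v ^ (n + 1) / (n + 1 : ℕ) - 3 * (v ^ (n + 2) / (n + 2 : ℕ)) +
        3 * (v ^ (n + 3) / (n + 3 : ℕ)) - v ^ (n + 4) / (n + 4 : ℕ)) ((1 - v) ^ 3 * v ^ n) v := by
    intro v _
    have hp : ∀ k : ℕ, HasDerivAt (fun v : ℝ => v ^ (k + 1) / (k + 1 : ℕ)) (v ^ k) v := by
      intro k
      refine ((hasDerivAt_pow (k + 1) v).div_const ((k + 1 : ℕ) : ℝ)).congr_deriv ?_
      rw [Nat.add_sub_cancel, mul_div_assoc, mul_div_cancel₀ _ (by positivity)]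
    refine ((((hp n).sub ((hp (n + 1)).const_mul 3)).add ((hp (n + 2)).const_mul 3)).sub
      (hp (n + 3))).congr_deriv ?_
    ring
  rw [intervalIntegral.integral_eq_sub_of_hasDerivAt h
    (Continuous.intervalIntegrable (by fun_prop) _ _)]
  simp
  field_simp
  ring

theorem hasSum_add_two_mul_pow_succ {u : ℝ} (hu : |u| < 1) :
    HasSum (fun m : ℕ => ((m : ℝ) + 2) * u ^ (m + 1)) (1 / (1 - u) ^ 2 - 1) := by
  have h0 : HasSum (fun n : ℕ => ((n : ℝ) + 1) * u ^ n) (1 / (1 - u) ^ 2) :=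
    (hasSum_choose_mul_geometric_of_norm_lt_one 1 (r := u) hu).of_eq
      (fun n => by rw [Nat.choose_one_right, Nat.cast_succ]) rfl
  refine ((hasSum_nat_add_iff' 1).2 h0).of_eq (fun m => ?_) (by simp)
  push_cast
  ring

theorem summable_mul_coeff_sinhTail_pow {x : ℝ} (hx : 0 ≤ x) (hx1 : x ≤ 1) :
    Summable fun p : ℕ × ℕ => ((p.1 : ℝ) + 2) *
      PowerSeries.coeff p.2 (sinhTail ^ (p.1 + 1)) * x ^ (p.1 + 1 + p.2) := by
  have hin : ∀ m : ℕ, HasSum (fun j : ℕ => ((m : ℝ) + 2) *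
      PowerSeries.coeff j (sinhTail ^ (m + 1)) * x ^ (m + 1 + j))
      (((m : ℝ) + 2) * (x * sinhTailSum x) ^ (m + 1)) := by
    intro m
    refine ((hasSum_sinhTail_pow x (m + 1)).2.mul_left (((m : ℝ) + 2) * x ^ (m + 1))).of_eq
      (fun j => ?_) ?_ <;> ring
  refine (summable_prod_of_nonneg fun p => ?_).2 ⟨fun m => (hin m).summable, ?_⟩
  · have := coeff_sinhTail_pow_nonneg (p.1 + 1) p.2
    change (0 : ℝ) ≤ _
    positivity
  · simp only [(hin _).tsum_eq]
    refine (hasSum_add_two_mul_pow_succ ?_).summable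
    rw [abs_of_nonneg (mul_nonneg hx (sinhTailSum_nonneg hx))]
    exact mul_sinhTailSum_lt_one hx hx1

/-- The terms of the double series expansion of `(1 - v) ^ 3 (y ^ 2 / sin (v y) ^ 2 - 1 / v ^ 2)`. -/
noncomputable def sinInvSqTerm (y : ℝ) (p : ℕ × ℕ) (v : ℝ) : ℝ :=
  ((p.1 : ℝ) + 2) * (-1) ^ p.2 * PowerSeries.coeff p.2 (sinhTail ^ (p.1 + 1)) *
    (y ^ 2) ^ (p.1 + 1 + p.2) * ((1 - v) ^ 3 * v ^ (2 * (p.1 + p.2)))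

theorem norm_sinInvSqTerm_le (y : ℝ) (p : ℕ × ℕ) {v : ℝ} (hv : v ∈ Set.Icc (0 : ℝ) 1) :
    ‖sinInvSqTerm y p v‖ ≤ ((p.1 : ℝ) + 2) *
      PowerSeries.coeff p.2 (sinhTail ^ (p.1 + 1)) * (y ^ 2) ^ (p.1 + 1 + p.2) := by
  have hc := coeff_sinhTail_pow_nonneg (p.1 + 1) p.2
  have h1 : 0 ≤ 1 - v := by linarith [hv.2]
  have h0 := hv.1
  rw [sinInvSqTerm, norm_mul, norm_mul, norm_mul, norm_mul, norm_pow, norm_neg, norm_one, one_pow,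
    mul_one, Real.norm_of_nonneg hc, Real.norm_of_nonneg (by positivity : (0 : ℝ) ≤ (p.1 : ℝ) + 2),
    Real.norm_of_nonneg (by positivity : (0 : ℝ) ≤ (y ^ 2) ^ (p.1 + 1 + p.2)),
    Real.norm_of_nonneg (by positivity : (0 : ℝ) ≤ (1 - v) ^ 3 * v ^ (2 * (p.1 + p.2)))]
  refine mul_le_of_le_one_right (by positivity) (mul_le_one₀ ?_ (by positivity) ?_)
  · exact pow_le_one₀ h1 (by linarith)
  · exact pow_le_one₀ h0 hv.2

theorem continuous_sinInvSqTerm (y : ℝ) (p : ℕ × ℕ) : Continuous (sinInvSqTerm y p) := by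
  unfold sinInvSqTerm
  fun_prop

theorem summable_sinInvSqTerm_bound {y : ℝ} (hy : 0 < y) (hy1 : y ≤ 1) :
    Summable fun p : ℕ × ℕ => ((p.1 : ℝ) + 2) *
      PowerSeries.coeff p.2 (sinhTail ^ (p.1 + 1)) * (y ^ 2) ^ (p.1 + 1 + p.2) :=
  summable_mul_coeff_sinhTail_pow (sq_nonneg y) (pow_le_one₀ hy.le hy1)

open Real in
-- Summing over the coefficient index first gives powers of u = 1 - sin(vy)/(vy), with 0 < 1 - u <
-- 1; the remaining sum is a differentiated geometric series.
theorem hasSum_sinInvSqTerm {y : ℝ} (hy : 0 < y) (hy1 : y ≤ 1) {v : ℝ}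
    (hv : v ∈ Set.Ioc (0 : ℝ) 1) :
    HasSum (fun p => sinInvSqTerm y p v)
      ((1 - v) ^ 3 * (y ^ 2 / sin (v * y) ^ 2 - 1 / v ^ 2)) := by
  have hs : Summable fun p => sinInvSqTerm y p v :=
    Summable.of_norm_bounded (summable_sinInvSqTerm_bound hy hy1)
      fun p => norm_sinInvSqTerm_le y p (Set.Ioc_subset_Icc_self hv)
  have hv0 : 0 < v := hv.1
  have hw : 0 < v * y := mul_pos hv0 hy
  have hsin : 0 < sin (v * y) := sin_pos_of_pos_of_lt_pi hw (by nlinarith [hv.2, pi_gt_three])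
  have hu : |1 - sin (v * y) / (v * y)| < 1 := by
    have h1 : sin (v * y) / (v * y) < 1 := (div_lt_one hw).2 (sin_lt hw)
    have h2 : 0 < sin (v * y) / (v * y) := div_pos hsin hw
    rw [abs_lt]
    constructor <;> linarith
  have hfib : ∀ m : ℕ, HasSum (fun j => sinInvSqTerm y (m, j) v)
      ((1 - v) ^ 3 / v ^ 2 * (((m : ℝ) + 2) * (1 - sin (v * y) / (v * y)) ^ (m + 1))) := by
    intro m
    refine ((hasSum_sinhTail_pow (-(v * y) ^ 2) (m + 1)).2.mul_left
      ((1 - v) ^ 3 / v ^ 2 * ((m : ℝ) + 2) * ((v * y) ^ 2) ^ (m + 1))).of_eq (fun j => ?_) ?_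
    · rw [sinInvSqTerm, neg_pow]
      simp only [pow_add, pow_mul, mul_pow]
      field_simp
    · have h := neg_sq_mul_sinhTailSum (v * y) hw.ne'
      have h' : 1 - sin (v * y) / (v * y) = (v * y) ^ 2 * sinhTailSum (-(v * y) ^ 2) := by
        linarith
      rw [h']
      ring
  have h1 := hs.hasSum.prod_fiberwise hfib
  have h2 := (hasSum_add_two_mul_pow_succ hu).mul_left ((1 - v) ^ 3 / v ^ 2)
  refine hs.hasSum.of_eq (fun _ => rfl) ((h1.unique h2).trans ?_)
  have hsin' := hsin.ne'
  rw [sub_sub_cancel]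
  field_simp

open Real in
theorem intervalIntegrable_one_sub_pow_mul_sin_inv_sq {y : ℝ} (hy : 0 < y) (hy1 : y ≤ 1) :
    IntervalIntegrable (fun v => (1 - v) ^ 3 * (y ^ 2 / sin (v * y) ^ 2 - 1 / v ^ 2))
      MeasureTheory.volume 0 1 := by
  have hc : ContinuousOn (fun v => ∑' p, sinInvSqTerm y p v) (Set.Icc 0 1) :=
    continuousOn_tsum (fun p => (continuous_sinInvSqTerm y p).continuousOn)
      (summable_sinInvSqTerm_bound hy hy1) fun p v hv => norm_sinInvSqTerm_le y p hv
  refine (hc.intervalIntegrable_of_Icc zero_le_one).congr fun v hv => ?_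
  rw [Set.uIoc_of_le zero_le_one] at hv
  exact (hasSum_sinInvSqTerm hy hy1 hv).tsum_eq

open Real in
theorem hasSum_integral_sinInvSqTerm {y : ℝ} (hy : 0 < y) (hy1 : y ≤ 1) :
    HasSum (fun p : ℕ × ℕ => ∫ v in (0 : ℝ)..1, sinInvSqTerm y p v)
      (∫ v in (0 : ℝ)..1, (1 - v) ^ 3 * (y ^ 2 / sin (v * y) ^ 2 - 1 / v ^ 2)) := by
  refine intervalIntegral.hasSum_integral_of_dominated_convergence
    (fun p _ => ((p.1 : ℝ) + 2) * PowerSeries.coeff p.2 (sinhTail ^ (p.1 + 1)) *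
      (y ^ 2) ^ (p.1 + 1 + p.2))
    (fun p => (continuous_sinInvSqTerm y p).aestronglyMeasurable) ?_ ?_ ?_ ?_
  · refine fun p => Filter.Eventually.of_forall fun v hv => norm_sinInvSqTerm_le y p ?_
    rw [Set.uIoc_of_le zero_le_one] at hv
    exact Set.Ioc_subset_Icc_self hv
  · exact Filter.Eventually.of_forall fun v _ => summable_sinInvSqTerm_bound hy hy1
  · exact intervalIntegrable_const
  · refine Filter.Eventually.of_forall fun v hv => ?_
    rw [Set.uIoc_of_le zero_le_one] at hv
    exact hasSum_sinInvSqTerm hy hy1 hv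

/-! ### Matching the two double series and conclusion -/

/-- Here n = m+1 and k = j+1. The square of π/(6√6) is y²/6, so the powers of 6 from P cancel up to
one factor; with the 6 of the Beta integral this leaves y²/36 = π²/1296. -/
theorem zetaThreeCoeffTerm_mul_pow (m j : ℕ) :
    (-1 : ℝ) ^ ((j + 1) + 1) * zetaThreeCoeffTerm (j + 1) (m + 1) *
      (Real.pi / (6 * Real.sqrt 6)) ^ (2 * (j + 1)) =
      Real.pi ^ 2 / 1296 * ∫ v in (0 : ℝ)..1, sinInvSqTerm (Real.pi / 6) (m, j) v := by
  have ht : (Real.pi / (6 * Real.sqrt 6)) ^ 2 = (Real.pi / 6) ^ 2 / 6 := by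
    rw [div_pow, mul_pow, Real.sq_sqrt (by norm_num), div_pow, div_div]
  have hb := bernoulliP_eq (m + 1) j (by omega)
  have hpos : (0 : ℝ) < (m : ℝ) + 1 := by positivity
  have e1 : 2 * ((m : ℝ) + 1) + 2 * ((j : ℝ) + 1) - 3 = 2 * (m + j) + 1 := by ring
  have e2 : 2 * ((m : ℝ) + 1) + 2 * ((j : ℝ) + 1) - 2 = 2 * (m + j) + 2 := by ring
  have e3 : 2 * ((m : ℝ) + 1) + 2 * ((j : ℝ) + 1) - 1 = 2 * (m + j) + 3 := by ring
  have e4 : 2 * ((m : ℝ) + 1) + 2 * ((j : ℝ) + 1) = 2 * (m + j) + 4 := by ring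
  simp only [sinInvSqTerm]
  rw [intervalIntegral.integral_const_mul, integral_one_sub_pow_three_mul_pow, zetaThreeCoeffTerm,
    show m + 1 + (j + 1) - 1 = m + 1 + j by omega, hb, pow_mul, pow_mul, ht]
  push_cast
  rw [e1, e2, e3, e4]
  simp only [pow_add, div_pow]
  field_simp
  ring

theorem hasSum_zetaThreeCoeffTerm {Z : ℝ} (hZ : HasSum (fun n : ℕ => 1 / (n : ℝ) ^ 3) Z) :
    HasSum (fun p : ℕ × ℕ => (-1 : ℝ) ^ ((p.1 + 1) + 1) *
      zetaThreeCoeffTerm (p.1 + 1) (p.2 + 1) * (Real.pi / (6 * Real.sqrt 6)) ^ (2 * (p.1 + 1)))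
      (Real.pi ^ 2 / 1296 * (3 * Real.log (Real.pi / 3) + 36 * Z / Real.pi ^ 2 - 9 / 2)) := by
  have hπ := Real.pi_pos
  have hy : 0 < Real.pi / 6 := by positivity
  have hy1 : Real.pi / 6 ≤ 1 := by linarith [Real.pi_lt_four]
  have h1 := (hasSum_integral_sinInvSqTerm hy hy1).mul_left (Real.pi ^ 2 / 1296)
  rw [integral_one_sub_pow_mul_sin_inv_sq_pi_div_six hZ
    (intervalIntegrable_one_sub_pow_mul_sin_inv_sq hy hy1)] at h1
  refine ((Equiv.prodComm ℕ ℕ).hasSum_iff.2 h1).of_eq (fun p => ?_) rfl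
  exact (zetaThreeCoeffTerm_mul_pow p.2 p.1).symm

/-- A row of the summable double family, with its nonzero constant factors cancelled. -/
theorem summable_zetaThreeCoeffTerm (j : ℕ) :
    Summable fun m : ℕ => zetaThreeCoeffTerm (j + 1) (m + 1) := by
  obtain ⟨Z, -, hZ⟩ := exists_hasSum_riemannZeta_three
  have hs := (hasSum_zetaThreeCoeffTerm hZ).summable.prod_factor j
  have hπ := Real.pi_pos
  have hne : (Real.pi / (6 * Real.sqrt 6)) ^ (2 * (j + 1)) ≠ 0 := by positivity
  have hne1 : (-1 : ℝ) ^ ((j + 1) + 1) ≠ 0 := pow_ne_zero _ (by norm_num)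
  exact (summable_mul_left_iff hne1).1 ((summable_mul_right_iff hne).1 hs)

theorem hasSum_zetaThreeCoeff {Z : ℝ} (hZ : HasSum (fun n : ℕ => 1 / (n : ℝ) ^ 3) Z) :
    HasSum (fun j : ℕ => (-1 : ℝ) ^ ((j + 1) + 1) * zetaThreeCoeff (j + 1) *
      (Real.pi / (6 * Real.sqrt 6)) ^ (2 * (j + 1)))
      (Real.pi ^ 2 / 1296 * (3 * Real.log (Real.pi / 3) + 36 * Z / Real.pi ^ 2 - 9 / 2)) :=
  (hasSum_zetaThreeCoeffTerm hZ).prod_fiberwise fun j =>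
    ((summable_zetaThreeCoeffTerm j).hasSum.mul_left _).mul_right _

theorem mainTheorem11 :
    (∀ k : ℕ, 1 ≤ k → Summable (fun n : ℕ => zetaThreeCoeffTerm k (n + 1))) ∧
    Summable (fun m : ℕ => (-1 : ℝ) ^ ((m + 1) + 1) * zetaThreeCoeff (m + 1) *
      (Real.pi / (6 * Real.sqrt 6)) ^ (2 * (m + 1))) ∧
    riemannZeta 3 =
      ((Real.pi ^ 2 / 8 - Real.pi ^ 2 / 12 * Real.log (Real.pi / 3) +
        36 * ∑' m : ℕ, (-1 : ℝ) ^ ((m + 1) + 1) * zetaThreeCoeff (m + 1) *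
          (Real.pi / (6 * Real.sqrt 6)) ^ (2 * (m + 1)) : ℝ) : ℂ) := by
  obtain ⟨Z, hZ3, hZ⟩ := exists_hasSum_riemannZeta_three
  have h := hasSum_zetaThreeCoeff hZ
  refine ⟨fun k hk => ?_, h.summable, ?_⟩
  · obtain ⟨j, rfl⟩ := Nat.exists_eq_add_of_le' hk
    exact summable_zetaThreeCoeffTerm j
  · have hπ := Real.pi_pos
    have hv : Real.pi ^ 2 / 8 - Real.pi ^ 2 / 12 * Real.log (Real.pi / 3) +
        36 * (Real.pi ^ 2 / 1296 * (3 * Real.log (Real.pi / 3) + 36 * Z / Real.pi ^ 2 - 9 / 2)) =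
        Z := by
      field_simp
      ring
    rw [h.tsum_eq, hZ3, hv]
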